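/- Let $N\ge 0$, let $(W^k)_{k\in K}$ be a finite family of complex Wiener processes on a probability space with a filtration $(\mathcal F_t)_{t\ge 0}$ (adapted, continuous, $W^k_0=0$, jointly centered Gaussian, with stationary increments independent of the past), with covariance $\mathbb{E}[W^k_tW^{k'*}_t]=a_{kk'}t$. For $k\in K$ let $v_k$ be a progressively measurable process with values in the complex $N\times N$ matrices such that $\mathbb{E}\int_0^t\|v_k(s)\|^2ds<\infty$ for all $t$. Let $U_{st}(t)$, $t\ge 0$, be random $N\times N$ matrices with $U_{st}(0)=I$ and, almost surely for each $t$, $$U_{st}(t)=\mathbb{E}U_{st}(t)+\sum_{k\in K}\int_0^t v_k(s)\,dW^k_s ,$$ the integrals being Itô integrals. For a density matrix $\rho(0)$ (positive semidefinite, of trace one) put $\rho_{QM}(t)=\mathbb{E}[U_{st}(t)\rho(0)U_{st}^\dagger(t)]$. Let $t\ge 0$ be such that $\operatorname{tr}\rho_{QM}(t)=\operatorname{tr}\rho_{QM}(0)$ for every density matrix $\rho(0)$. Then $$I-\mathbb{E}\sum_{n,m\in K}a_{nm}\int_0^t v_m^\dagger(s)v_n(s)\,ds$$ is positive semidefinite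 and there is a selfadjoint matrix $H$, which may depend on $t$, with $$\mathbb{E}U_{st}(t)=\exp(-iHt)\Bigl(I-\mathbb{E}\sum_{n,m\in K}a_{nm}\int_0^t v_m^\dagger(s)v_n(s)\,ds\Bigr)^{1/2}.$$ In particular, if the $v_k$ are not random, then $I-\sum_{n,m}a_{nm}\int_0^t v_m^\dagger(s)v_n(s)\,ds$ is positive semidefinite and $$\mathbb{E}U_{st}(t)=\exp(-iHt)\Bigl(I-\sum_{n,m\in K}a_{nm}\int_0^t v_m^\dagger(s)v_n(s)\,ds\Bigr)^{1/2}.$$ -/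

import Mathlib

open MeasureTheory ProbabilityTheory Filter Topology
open scoped NNReal ENNReal MatrixOrder ComplexOrder ComplexConjugate

/-- `W = (W k)` is a (finite) family of complex Wiener processes with respect to the filtration
`𝓕`, with covariance matrix `𝔼[W k t * conj (W k' t)] = a k k' * t`: the vector `(W k)` is adapted,
starts at `0`, has continuous paths, is a centered Gaussian vector at each time, and has stationary
increments which are independent of the past. Nothing is imposed on the pseudo-covariances
`𝔼[W k t * W k' t]`: the circular case, in which they vanish, and the real case are both
included. -/
structure IsComplexWiener {Ω ι : Type*} [mΩ : MeasurableSpace Ω] [Fintype ι]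
    (𝓕 : Filtration ℝ≥0 mΩ) (P : Measure Ω) (a : Matrix ι ι ℂ) (W : ι → ℝ≥0 → Ω → ℂ) : Prop where
  adapted : ∀ k t, Measurable[𝓕 t] (W k t)
  start_zero : ∀ k, ∀ᵐ ω ∂P, W k 0 ω = 0
  continuous_paths : ∀ k, ∀ᵐ ω ∂P, Continuous fun t ↦ W k t ω
  gaussian : ∀ t, HasGaussianLaw (fun ω k ↦ W k t ω) P
  centered : ∀ k t, ∫ ω, W k t ω ∂P = 0
  stationary : ∀ s t, IdentDistrib (fun ω k ↦ W k (s + t) ω - W k s ω) (fun ω k ↦ W k t ω) P P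
  indep : ∀ s t, Indep (MeasurableSpace.comap (fun ω k ↦ W k (s + t) ω - W k s ω) inferInstance)
    (𝓕 s) P
  covariance : ∀ k k' t, ∫ ω, W k t ω * conj (W k' t ω) ∂P = a k k' * ((t : ℝ) : ℂ)

/-- Lebesgue measure on the time interval `[0, t]`, as a measure on `ℝ≥0`. -/
noncomputable def timeMeasure (t : ℝ≥0) : Measure ℝ≥0 :=
  (volume.restrict (Set.Icc (0 : ℝ) t)).map Real.toNNReal

/-- A simple process `∑ i, coef i * 1_{(left i, right i]}`, in which the coefficient of an interval
is bounded and measurable with respect to the past of its left end point. -/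
structure SimpleProcess {Ω : Type*} [mΩ : MeasurableSpace Ω] (𝓕 : Filtration ℝ≥0 mΩ) where
  /-- the number of terms -/
  size : ℕ
  /-- left end points -/
  left : Fin size → ℝ≥0
  /-- right end points -/
  right : Fin size → ℝ≥0
  /-- random coefficients -/
  coef : Fin size → Ω → ℂ
  left_le_right : ∀ i, left i ≤ right i
  measurable_coef : ∀ i, Measurable[𝓕 (left i)] (coef i)
  bounded_coef : ∀ i, ∃ C : ℝ, ∀ ω, ‖coef i ω‖ ≤ C

namespace SimpleProcess

variable {Ω : Type*} [mΩ : MeasurableSpace Ω] {𝓕 : Filtration ℝ≥0 mΩ}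

/-- The value of a simple process at time `s`. -/
noncomputable def eval (φ : SimpleProcess 𝓕) (s : ℝ≥0) (ω : Ω) : ℂ :=
  ∑ i, (Set.Ioc (φ.left i) (φ.right i)).indicator (fun _ ↦ φ.coef i ω) s

/-- The elementary stochastic integral `∫₀ᵗ φ dW` of a simple process. -/
noncomputable def integral (φ : SimpleProcess 𝓕) (W : ℝ≥0 → Ω → ℂ) (t : ℝ≥0) (ω : Ω) : ℂ :=
  ∑ i, φ.coef i ω * (W (min t (φ.right i)) ω - W (min t (φ.left i)) ω)

end SimpleProcess

/-- `X` is (a version of) the Itô integral `∫₀ᵗ f dW`: the limit in `L²(P)` of the elementary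
integrals of simple processes that converge to `f` in `L²([0, t] × Ω)`. -/
def IsItoIntegral {Ω : Type*} [mΩ : MeasurableSpace Ω] (𝓕 : Filtration ℝ≥0 mΩ) (P : Measure Ω)
    (W : ℝ≥0 → Ω → ℂ) (f : ℝ≥0 → Ω → ℂ) (t : ℝ≥0) (X : Ω → ℂ) : Prop :=
  MemLp X 2 P ∧ ∃ φ : ℕ → SimpleProcess 𝓕,
    Tendsto (fun n ↦ eLpNorm (fun p : ℝ≥0 × Ω ↦ (φ n).eval p.1 p.2 - f p.1 p.2) 2
      ((timeMeasure t).prod P)) atTop (𝓝 0) ∧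
    Tendsto (fun n ↦ eLpNorm (fun ω ↦ (φ n).integral W t ω - X ω) 2 P) atTop (𝓝 0)

/-- `v` is an integrand for operator-valued Itô integrals: each matrix entry is progressively
measurable and square integrable on `[0, t] × Ω` for every `t`. -/
structure IsItoIntegrand {Ω n : Type*} [mΩ : MeasurableSpace Ω] (𝓕 : Filtration ℝ≥0 mΩ)
    (P : Measure Ω) (v : ℝ≥0 → Ω → Matrix n n ℂ) : Prop where
  progressive : ∀ i j, IsStronglyProgressive 𝓕 (fun s ω ↦ v s ω i j)
  square_integrable : ∀ i j t, MemLp (fun p : ℝ≥0 × Ω ↦ v p.1 p.2 i j) 2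
    ((timeMeasure t).prod P)

/-- `X` is (a version of) the operator-valued Itô integral `∫₀ᵗ v(s) dW_s` of a matrix-valued
process against a scalar one, taken entry by entry. -/
def IsMatrixItoIntegral {Ω n : Type*} [mΩ : MeasurableSpace Ω] (𝓕 : Filtration ℝ≥0 mΩ)
    (P : Measure Ω) (W : ℝ≥0 → Ω → ℂ) (v : ℝ≥0 → Ω → Matrix n n ℂ) (t : ℝ≥0)
    (X : Ω → Matrix n n ℂ) : Prop :=
  ∀ i j, IsItoIntegral 𝓕 P W (fun s ω ↦ v s ω i j) t (fun ω ↦ X ω i j)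

/-- The expectation `𝔼 X` of a random matrix, entry by entry. -/
noncomputable def matrixExpectation {Ω n : Type*} [MeasurableSpace Ω] (P : Measure Ω)
    (X : Ω → Matrix n n ℂ) : Matrix n n ℂ :=
  Matrix.of fun i j ↦ ∫ ω, X ω i j ∂P

/-- The Lebesgue integral `∫₀ᵗ A(s) ds` of a matrix-valued function, entry by entry. -/
noncomputable def matrixTimeIntegral {n : Type*} (t : ℝ≥0) (A : ℝ≥0 → Matrix n n ℂ) :
    Matrix n n ℂ :=
  Matrix.of fun i j ↦ ∫ s, A s i j ∂(timeMeasure t)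

/-- `U` is a stochastic evolution operator with noise coefficients `v k` and noises `W k`:
`U 0 = I` and, almost surely at each time, `U t = 𝔼 (U t) + ∑ k, ∫₀ᵗ v k s dW^k_s`. -/
structure IsStochasticEvolution {Ω ι n : Type*} [mΩ : MeasurableSpace Ω] [Fintype ι]
    [DecidableEq n] (𝓕 : Filtration ℝ≥0 mΩ) (P : Measure Ω) (W : ι → ℝ≥0 → Ω → ℂ)
    (v : ι → ℝ≥0 → Ω → Matrix n n ℂ) (U : ℝ≥0 → Ω → Matrix n n ℂ) : Prop where
  start_one : ∀ᵐ ω ∂P, U 0 ω = 1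
  decomposition : ∀ t, ∃ J : ι → Ω → Matrix n n ℂ,
    (∀ k, IsMatrixItoIntegral 𝓕 P (W k) (v k) t (J k)) ∧
    ∀ᵐ ω ∂P, U t ω = matrixExpectation P (U t) + ∑ k, J k ω

/-- Density operators: positive semidefinite matrices of trace one. -/
def IsDensityMatrix {n : Type*} [Fintype n] (ρ : Matrix n n ℂ) : Prop :=
  ρ.PosSemidef ∧ ρ.trace = 1

/-- The mean density operator `ρ_QM(t) = 𝔼 [U(t) ρ(0) U(t)†]`. -/
noncomputable def rhoQM {Ω n : Type*} [MeasurableSpace Ω] [Fintype n] (P : Measure Ω)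
    (U : ℝ≥0 → Ω → Matrix n n ℂ) (ρ₀ : Matrix n n ℂ) (t : ℝ≥0) : Matrix n n ℂ :=
  matrixExpectation P fun ω ↦ U t ω * ρ₀ * (U t ω).conjTranspose

/-- The operator `∑ n m, a n m ∫₀ᵗ v_m(s)† v_n(s) ds`, along the sample point `ω`. -/
noncomputable def noiseOperator {Ω ι n : Type*} [Fintype ι] [Fintype n] (a : Matrix ι ι ℂ)
    (v : ι → ℝ≥0 → Ω → Matrix n n ℂ) (t : ℝ≥0) (ω : Ω) : Matrix n n ℂ :=
  ∑ k, ∑ l, a k l • matrixTimeIntegral t fun s ↦ (v l s ω).conjTranspose * v k s ω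

/-! Write $A=\mathbb{E}U(t)$ and let $Z$ be the sum of the Itô integrals. By cyclicity of the trace,
$\operatorname{tr}\rho_{QM}(t)=\operatorname{tr}(\mathbb{E}[U^\dagger U]\rho(0))$, so conservation
of the trace for every density matrix means $\mathbb{E}[U^\dagger U]=I$
(`Matrix.eq_one_of_forall_isDensityMatrix`). Since $Z$ is centred, the cross terms vanish and
$I=A^\dagger A+\mathbb{E}[Z^\dagger Z]$; the Itô isometry identifies $\mathbb{E}[Z^\dagger Z]$ with
the mean noise operator. Hence $I$ minus that operator is $A^\dagger A$, and the claim is the polar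
decomposition of $A$ with its unitary factor written as an exponential
(`Matrix.exists_exp_mul_sqrt`).

The isometry `IsItoIntegral.integral_mul_conj` is first computed for simple processes, from the
independence and stationarity of increments, and then carried to $L^2$ limits by continuity of the
inner product. -/

section MatrixPolar

/-! ### Polar decomposition and exponentials of matrices. -/

theorem Matrix.trace_mul_vecMulVec_star {n : Type*} [Fintype n] (M : Matrix n n ℂ) (x : n → ℂ) :
    (M * Matrix.vecMulVec x (star x)).trace = star x ⬝ᵥ M.mulVec x := by
  rw [Matrix.mul_vecMulVec, Matrix.trace_vecMulVec, dotProduct_comm]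

variable {n : Type*} [Fintype n] [DecidableEq n]

open scoped Matrix.Norms.L2Operator in
/-- Every unitary matrix is the exponential of `i` times a Hermitian matrix. -/
theorem Matrix.exists_isHermitian_exp_I_smul_l2 (V : Matrix n n ℂ) (hV : V ∈ unitary (Matrix n n ℂ)) :
    ∃ H : Matrix n n ℂ, H.IsHermitian ∧ NormedSpace.exp (Complex.I • H) = V := by
  have hn : IsStarNormal V := 
    ⟨(Unitary.star_mul_self_of_mem hV).trans (Unitary.mul_star_self_of_mem hV).symm⟩
  -- On a finite spectrum every function is continuous, even the discontinuous `Complex.arg`.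
  have hfin : (spectrum ℂ V).Finite := Matrix.finite_spectrum V
  have hc : ∀ f : ℂ → ℂ, ContinuousOn f (spectrum ℂ V) := fun f ↦ hfin.continuousOn f
  have hc' : ∀ f g : ℂ → ℂ, ContinuousOn f (g '' spectrum ℂ V) :=
    fun f g ↦ (hfin.image g).continuousOn f
  refine ⟨cfc (fun z : ℂ ↦ ((Complex.arg z : ℝ) : ℂ)) V, ?_, ?_⟩
  · rw [Matrix.IsHermitian, ← Matrix.star_eq_conjTranspose, ← cfc_star]
    congr 1
    ext z
    simp
  · rw [← cfc_smul (R := ℂ) Complex.I (fun z : ℂ ↦ ((Complex.arg z : ℝ) : ℂ)) V (hc _),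
      ← CFC.exp_eq_normedSpace_exp (𝕜 := ℂ) (cfc_predicate _ _),
      ← cfc_comp' (NormedSpace.exp) _ V (hc' _ _) (hc _)]
    conv_rhs => rw [← cfc_id ℂ V]
    refine cfc_congr fun z hz ↦ ?_
    have h1 : ‖z‖ = 1 := spectrum.norm_eq_one_of_unitary hV hz
    have h2 := Complex.norm_mul_exp_arg_mul_I z
    rw [h1, Complex.ofReal_one, one_mul] at h2
    simp only [← Complex.exp_eq_exp_ℂ, smul_eq_mul, id]
    rw [mul_comm]
    exact h2

/-- The functional calculus above works with the L2 operator norm in scope; the exponential sees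
only the topology, so the result is freed from that norm here. -/
theorem Matrix.exists_isHermitian_exp_I_smul (V : Matrix n n ℂ) (hV : V ∈ unitary (Matrix n n ℂ)) :
    ∃ H : Matrix n n ℂ, H.IsHermitian ∧ NormedSpace.exp (Complex.I • H) = V :=
  Matrix.exists_isHermitian_exp_I_smul_l2 V hV

/-- If `AᴴA = RᴴR`, then `A` and `R` differ by a unitary factor. -/
theorem Matrix.exists_unitary_mul_eq {A R : Matrix n n ℂ}
    (h : A.conjTranspose * A = R.conjTranspose * R) :
    ∃ V ∈ unitary (Matrix n n ℂ), A = V * R := by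
  let T := Matrix.toEuclideanLin A
  let S := Matrix.toEuclideanLin R
  have hnorm : ∀ x, ‖T x‖ = ‖S x‖ := by
    intro x
    have : ∀ B : Matrix n n ℂ, inner ℂ (B.toEuclideanLin x) (B.toEuclideanLin x) =
        inner ℂ x ((B.conjTranspose * B).toEuclideanLin x) := by
      intro B
      rw [← LinearMap.adjoint_inner_right, ← Matrix.toEuclideanLin_conjTranspose_eq_adjoint]
      simp [Matrix.toLpLin_apply, Matrix.mulVec_mulVec]
    have h2 : inner ℂ (T x) (T x) = inner ℂ (S x) (S x) := by
      rw [this A, this R, h]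
    rw [inner_self_eq_norm_sq_to_K, inner_self_eq_norm_sq_to_K] at h2
    have h3 : ‖T x‖ ^ 2 = ‖S x‖ ^ 2 := by exact_mod_cast h2
    exact (pow_left_inj₀ (norm_nonneg _) (norm_nonneg _) two_ne_zero).1 h3
  obtain ⟨g, hg⟩ := LinearMap.exists_rightInverse_of_surjective S.rangeRestrict
    (LinearMap.range_rangeRestrict S)
  have hg' : ∀ y, S (g y) = y := fun y ↦ congrArg Subtype.val (LinearMap.congr_fun hg y)
  -- The isometry sending `S x` to `T x`, built on the range of `S` through a linear section `g`. By
  -- `hnorm` the choice of `g` is immaterial. Its isometric extension to the whole space is the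
  -- unitary factor, also when `R` is singular.
  let L₀ : LinearMap.range S →ₗᵢ[ℂ] EuclideanSpace ℂ n :=
    ⟨T ∘ₗ g, fun y ↦ by
      rw [LinearMap.comp_apply, hnorm, hg', Submodule.coe_norm]⟩
  let L := L₀.extend
  have hL : ∀ x, L (S x) = T x := by
    intro x
    have h1 : L (S x) = T (g ⟨S x, LinearMap.mem_range_self S x⟩) :=
      L₀.extend_apply ⟨S x, LinearMap.mem_range_self S x⟩
    rw [h1, ← sub_eq_zero, ← map_sub, ← norm_eq_zero, hnorm, map_sub, hg', sub_self, norm_zero]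
  refine ⟨Matrix.toEuclideanLin.symm L.toLinearMap, ?_, ?_⟩
  · have h1 : star (Matrix.toEuclideanLin.symm L.toLinearMap) *
        Matrix.toEuclideanLin.symm L.toLinearMap = (1 : Matrix n n ℂ) := by
      apply Matrix.toEuclideanLin.injective
      refine LinearMap.ext fun x ↦ ext_inner_left ℂ fun y ↦ ?_
      have h2 : ∀ (B C : Matrix n n ℂ), (B * C).toEuclideanLin x =
          B.toEuclideanLin (C.toEuclideanLin x) := fun B C ↦ by
        simp [Matrix.toLpLin_apply, Matrix.mulVec_mulVec]
      rw [h2, Matrix.star_eq_conjTranspose, Matrix.toEuclideanLin_conjTranspose_eq_adjoint,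
        LinearMap.adjoint_inner_right]
      simp only [LinearEquiv.apply_symm_apply]
      simp
    exact Unitary.mem_iff.2 ⟨h1, mul_eq_one_comm.1 h1⟩
  · apply Matrix.toEuclideanLin.injective
    refine LinearMap.ext fun x ↦ ?_
    have h2 : ∀ (B C : Matrix n n ℂ), (B * C).toEuclideanLin x =
        B.toEuclideanLin (C.toEuclideanLin x) := fun B C ↦ by
      simp [Matrix.toLpLin_apply, Matrix.mulVec_mulVec]
    rw [h2, LinearEquiv.apply_symm_apply]
    exact (hL x).symm

/-- Polar decomposition with the unitary factor written as an exponential. -/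
theorem Matrix.exists_exp_mul_sqrt (A : Matrix n n ℂ) {c : ℂ} (hc : conj c = c) (hc0 : c ≠ 0) :
    ∃ H : Matrix n n ℂ, H.IsHermitian ∧
      A = NormedSpace.exp ((-(Complex.I * c)) • H) * CFC.sqrt (A.conjTranspose * A) := by
  have hS : 0 ≤ A.conjTranspose * A :=
    Matrix.nonneg_iff_posSemidef.2 (Matrix.posSemidef_conjTranspose_mul_self A)
  have hR := Matrix.nonneg_iff_posSemidef.1 (CFC.sqrt_nonneg (A.conjTranspose * A))
  obtain ⟨V, hV, hA⟩ := Matrix.exists_unitary_mul_eq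
    (A := A) (R := CFC.sqrt (A.conjTranspose * A)) (by
      rw [hR.isHermitian.eq, CFC.sqrt_mul_sqrt_self _ hS])
  obtain ⟨H, hH, rfl⟩ := Matrix.exists_isHermitian_exp_I_smul V hV
  -- Rescaling absorbs the prescribed factor $-ic$; it preserves selfadjointness because `c` is
  -- real.
  refine ⟨(-c⁻¹) • H, ?_, ?_⟩
  · rw [Matrix.IsHermitian, Matrix.conjTranspose_smul, hH.eq]
    simp [hc]
  · rw [smul_smul]
    have : -(Complex.I * c) * -c⁻¹ = Complex.I := by field_simp
    rw [this]
    exact hA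

/-- A matrix that pairs to `1` with every density matrix is the identity. -/
theorem Matrix.eq_one_of_forall_isDensityMatrix (M : Matrix n n ℂ)
    (h : ∀ ρ : Matrix n n ℂ, IsDensityMatrix ρ → (M * ρ).trace = 1) : M = 1 := by
  rw [← sub_eq_zero]
  apply Matrix.toEuclideanLin.injective
  -- Over ℂ an operator with zero quadratic form vanishes, so the rank-one densities
  -- $xx^\dagger/\|x\|^2$ suffice as tests.
  rw [map_zero, ← inner_map_self_eq_zero]
  intro x
  by_cases hx : x = 0
  · simp [hx]
  have hpos : (0 : ℂ) < star x.ofLp ⬝ᵥ x.ofLp := by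
    have : x.ofLp ≠ 0 := fun h ↦ hx (by ext i; exact congrFun h i)
    exact Matrix.dotProduct_star_self_pos_iff.2 this
  set r : ℂ := star x.ofLp ⬝ᵥ x.ofLp with hr
  have hd : IsDensityMatrix (r⁻¹ • Matrix.vecMulVec x.ofLp (star x.ofLp)) := by
    refine ⟨(Matrix.posSemidef_vecMulVec_self_star _).smul (inv_nonneg.2 hpos.le), ?_⟩
    rw [Matrix.trace_smul, Matrix.trace_vecMulVec, dotProduct_comm, smul_eq_mul, ← hr,
      inv_mul_cancel₀ hpos.ne']
  have h1 := h _ hd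
  rw [Matrix.mul_smul, Matrix.trace_smul, Matrix.trace_mul_vecMulVec_star, smul_eq_mul,
    inv_mul_eq_one₀ hpos.ne'] at h1
  have h2 : star x.ofLp ⬝ᵥ (M - 1).mulVec x.ofLp = 0 := by
    rw [Matrix.sub_mulVec, Matrix.one_mulVec, dotProduct_sub, ← h1, hr, sub_self]
  rw [← inner_conj_symm, Matrix.toLpLin_apply, EuclideanSpace.inner_eq_star_dotProduct]
  rw [dotProduct_comm] at h2
  simp [h2]

end MatrixPolar

/-! ### Products of square integrable functions. -/

section SquareIntegrable

variable {α : Type*} {m : MeasurableSpace α} {μ : Measure α} {f g : α → ℂ}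

theorem MeasureTheory.MemLp.conj {p : ℝ≥0∞} (hf : MemLp f p μ) :
    MemLp (fun x ↦ conj (f x)) p μ :=
  hf.star

theorem MeasureTheory.MemLp.integrable_mul_conj (hf : MemLp f 2 μ) (hg : MemLp g 2 μ) :
    Integrable (fun x ↦ f x * conj (g x)) μ :=
  hf.integrable_mul hg.conj

theorem MeasureTheory.MemLp.bounded_mul (hg : MemLp g 2 μ) (hf : Measurable f)
    (hb : ∃ C : ℝ, ∀ x, ‖f x‖ ≤ C) : MemLp (fun x ↦ f x * g x) 2 μ := by
  obtain ⟨C, hC⟩ := hb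
  refine (hg.const_mul (C : ℂ)).mono (hf.aestronglyMeasurable.mul hg.1) (ae_of_all _ fun x ↦ ?_)
  rw [norm_mul, norm_mul, Complex.norm_real]
  gcongr
  exact (hC x).trans (le_abs_self C)

end SquareIntegrable

/-! ### Covariances of weighted Wiener increments. -/

namespace IsComplexWiener

variable {Ω ι : Type*} [mΩ : MeasurableSpace Ω] [Fintype ι] {𝓕 : Filtration ℝ≥0 mΩ}
  {P : Measure Ω} {a : Matrix ι ι ℂ} {W : ι → ℝ≥0 → Ω → ℂ}

theorem memLp (hW : IsComplexWiener 𝓕 P a W) (k : ι) (s : ℝ≥0) : MemLp (W k s) 2 P :=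
  ((hW.gaussian s).eval k).memLp_two

theorem memLp_increment (hW : IsComplexWiener 𝓕 P a W) (k : ι) (s u : ℝ≥0) :
    MemLp (fun ω ↦ W k u ω - W k s ω) 2 P :=
  (hW.memLp k u).sub (hW.memLp k s)

theorem measurable_increment (hW : IsComplexWiener 𝓕 P a W) (k : ι) {s u : ℝ≥0} (h : s ≤ u) :
    Measurable[𝓕 u] fun ω ↦ W k u ω - W k s ω :=
  (hW.adapted k u).sub ((hW.adapted k s).mono (𝓕.mono h) le_rfl)

theorem integral_increment (hW : IsComplexWiener 𝓕 P a W) (k : ι) (s u : ℝ≥0) :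
    ∫ ω, (W k u ω - W k s ω) ∂P = 0 := by
  have := (hW.gaussian 0).isProbabilityMeasure
  rw [integral_sub ((hW.memLp k u).integrable one_le_two)
    ((hW.memLp k s).integrable one_le_two), hW.centered, hW.centered, sub_zero]

theorem integral_increment_mul_conj (hW : IsComplexWiener 𝓕 P a W) (k l : ι) {s u : ℝ≥0}
    (h : s ≤ u) :
    ∫ ω, (W k u ω - W k s ω) * conj (W l u ω - W l s ω) ∂P =
      a k l * (((u - s : ℝ≥0) : ℝ) : ℂ) := by
  have hm : Measurable fun x : ι → ℂ ↦ x k * conj (x l) := by fun_prop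
  have h1 := ((hW.stationary s (u - s)).comp hm).integral_eq
  rw [← hW.covariance, ← add_tsub_cancel_of_le h]
  simpa [Function.comp_def] using h1

/-- A function `g` of the whole increment vector is allowed so that products of two components are
covered as well. -/
theorem indepFun_increment (hW : IsComplexWiener 𝓕 P a W) {s u : ℝ≥0} (h : s ≤ u)
    {X : Ω → ℂ} (hX : Measurable[𝓕 s] X) {g : (ι → ℂ) → ℂ} (hg : Measurable g) :
    IndepFun X (fun ω ↦ g fun k ↦ W k u ω - W k s ω) P := by
  have h1 := hW.indep s (u - s)
  rw [add_tsub_cancel_of_le h] at h1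
  rw [IndepFun_iff_Indep]
  refine indep_of_indep_of_le_left (indep_of_indep_of_le_right h1.symm ?_) hX.comap_le
  exact (hg.comp (comap_measurable fun ω k ↦ W k u ω - W k s ω)).comap_le

/-- The martingale property. The product formula for independent functions needs only measurability,
so `X` need not be integrable. -/
theorem integral_mul_increment (hW : IsComplexWiener 𝓕 P a W) (k : ι) {s u : ℝ≥0} (h : s ≤ u)
    {X : Ω → ℂ} (hX : Measurable[𝓕 s] X) :
    ∫ ω, X ω * (W k u ω - W k s ω) ∂P = 0 := by
  have h1 := (hW.indepFun_increment h hX (g := fun x ↦ x k)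
    (by fun_prop)).integral_fun_mul_eq_mul_integral
    (hX.mono (𝓕.le s) le_rfl).aestronglyMeasurable (hW.memLp_increment k s u).1
  rw [h1, hW.integral_increment, mul_zero]

theorem integral_mul_conj_increment (hW : IsComplexWiener 𝓕 P a W) (k : ι) {s u : ℝ≥0}
    (h : s ≤ u) {X : Ω → ℂ} (hX : Measurable[𝓕 s] X) :
    ∫ ω, X ω * conj (W k u ω - W k s ω) ∂P = 0 := by
  have h1 := hW.integral_mul_increment k h (X := fun ω ↦ conj (X ω))
    (Complex.continuous_conj.measurable.comp hX)
  have h2 := congrArg conj h1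
  rw [← integral_conj] at h2
  simpa using h2

theorem integral_mul_increment_mul_conj (hW : IsComplexWiener 𝓕 P a W) (k l : ι) {s u : ℝ≥0}
    (h : s ≤ u) {X : Ω → ℂ} (hX : Measurable[𝓕 s] X) :
    ∫ ω, X ω * ((W k u ω - W k s ω) * conj (W l u ω - W l s ω)) ∂P =
      (∫ ω, X ω ∂P) * (a k l * (((u - s : ℝ≥0) : ℝ) : ℂ)) := by
  have h1 := (hW.indepFun_increment h hX (g := fun x ↦ x k * conj (x l))
    (by fun_prop)).integral_fun_mul_eq_mul_integral
    (hX.mono (𝓕.le s) le_rfl).aestronglyMeasurable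
    ((hW.memLp_increment k s u).integrable_mul_conj (hW.memLp_increment l s u)).1
  rw [h1, hW.integral_increment_mul_conj k l h]

/-- Covariance of two weighted increments with the same left end point. -/
theorem integral_weighted_increment_of_left_eq (hW : IsComplexWiener 𝓕 P a W) (k l : ι)
    {r q q' : ℝ≥0} (hq : r ≤ q) (hq' : r ≤ q') {c d : Ω → ℂ} (hc : Measurable[𝓕 r] c)
    (hd : Measurable[𝓕 r] d) (hcb : ∃ C : ℝ, ∀ ω, ‖c ω‖ ≤ C) (hdb : ∃ C : ℝ, ∀ ω, ‖d ω‖ ≤ C) :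
    ∫ ω, (c ω * (W k q ω - W k r ω)) * conj (d ω * (W l q' ω - W l r ω)) ∂P =
      (∫ ω, c ω * conj (d ω) ∂P) * (a k l * (((min q q' - r : ℝ≥0) : ℝ) : ℂ)) := by
  have hconj : Measurable (conj : ℂ → ℂ) := Complex.continuous_conj.measurable
  have hc' := hc.mono (𝓕.le r) le_rfl
  have hd' := hd.mono (𝓕.le r) le_rfl
  have hcd : Measurable[𝓕 r] fun ω ↦ c ω * conj (d ω) := hc.mul (hconj.comp hd)
  -- The longer increment is cut at `min q q'`; its later piece is independent of everything else in
  -- the product and contributes zero.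
  rcases le_total q q' with h | h
  · rw [min_eq_left h, ← hW.integral_mul_increment_mul_conj k l hq hcd]
    have hz : ∫ ω, (c ω * (W k q ω - W k r ω) * conj (d ω)) * conj (W l q' ω - W l q ω) ∂P = 0 :=
      hW.integral_mul_conj_increment l h
        (((hc.mono (𝓕.mono hq) le_rfl).mul (hW.measurable_increment k hq)).mul
          (hconj.comp (hd.mono (𝓕.mono hq) le_rfl)))
    have hi (u v : ℝ≥0) := ((hW.memLp_increment k r q).bounded_mul hc' hcb).integrable_mul_conj
      ((hW.memLp_increment l u v).bounded_mul hd' hdb)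
    calc _ = ∫ ω, ((c ω * (W k q ω - W k r ω)) * conj (d ω * (W l q ω - W l r ω)) +
          (c ω * (W k q ω - W k r ω)) * conj (d ω * (W l q' ω - W l q ω))) ∂P := by
            congr 1; ext ω; simp only [map_mul, map_sub]; ring
      _ = _ := by
        rw [integral_add (hi _ _) (hi _ _)]
        simp only [map_mul, ← mul_assoc] at hz ⊢
        rw [hz, add_zero]
        congr 1; ext ω; ring
  · rw [min_eq_right h, ← hW.integral_mul_increment_mul_conj k l hq' hcd]
    have hz : ∫ ω, (c ω * conj (d ω * (W l q' ω - W l r ω))) * (W k q ω - W k q' ω) ∂P = 0 :=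
      hW.integral_mul_increment k h
        ((hc.mono (𝓕.mono hq') le_rfl).mul (hconj.comp
          ((hd.mono (𝓕.mono hq') le_rfl).mul (hW.measurable_increment l hq'))))
    have hi (u v : ℝ≥0) := ((hW.memLp_increment k u v).bounded_mul hc' hcb).integrable_mul_conj
      ((hW.memLp_increment l r q').bounded_mul hd' hdb)
    calc _ = ∫ ω, ((c ω * (W k q' ω - W k r ω)) * conj (d ω * (W l q' ω - W l r ω)) +
          (c ω * (W k q ω - W k q' ω)) * conj (d ω * (W l q' ω - W l r ω))) ∂P := by
            congr 1; ext ω; ring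
      _ = _ := by
        rw [integral_add (hi _ _) (hi _ _)]
        have hz' : ∫ ω, (c ω * (W k q ω - W k q' ω)) * conj (d ω * (W l q' ω - W l r ω)) ∂P = 0 := by
          rw [← hz]; congr 1; ext ω; ring
        rw [hz', add_zero]
        congr 1; ext ω; simp only [map_mul]; ring

/-- Covariance of two weighted increments over arbitrary intervals. -/
theorem integral_weighted_increment (hW : IsComplexWiener 𝓕 P a W) (k l : ι)
    {p q p' q' : ℝ≥0} (hq : p ≤ q) (hq' : p' ≤ q') {c d : Ω → ℂ} (hc : Measurable[𝓕 p] c)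
    (hd : Measurable[𝓕 p'] d) (hcb : ∃ C : ℝ, ∀ ω, ‖c ω‖ ≤ C) (hdb : ∃ C : ℝ, ∀ ω, ‖d ω‖ ≤ C) :
    ∫ ω, (c ω * (W k q ω - W k p ω)) * conj (d ω * (W l q' ω - W l p' ω)) ∂P =
      (∫ ω, c ω * conj (d ω) ∂P) * (a k l * (((min q q' - max p p' : ℝ≥0) : ℝ) : ℂ)) := by
  have hconj : Measurable (conj : ℂ → ℂ) := Complex.continuous_conj.measurable
  have hc' := hc.mono (𝓕.le p) le_rfl
  have hd' := hd.mono (𝓕.le p') le_rfl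
  -- The interval that starts earlier is cut at the later left end point: the piece before it is
  -- orthogonal to the other increment, and the rest has a common left end point.
  rcases le_total p p' with h | h
  · rw [max_eq_right h]
    have hz (r : ℝ≥0) (hr : p ≤ r) (hr' : r ≤ p') :
        ∫ ω, (c ω * (W k r ω - W k p ω)) * conj (d ω * (W l q' ω - W l p' ω)) ∂P = 0 := by
      rw [← hW.integral_mul_conj_increment l hq' (X := fun ω ↦
        c ω * (W k r ω - W k p ω) * conj (d ω))
        ((((hc.mono (𝓕.mono hr) le_rfl).mul (hW.measurable_increment k hr)).mono
          (𝓕.mono hr') le_rfl).mul (hconj.comp hd))]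
      congr 1; ext ω; simp only [map_mul]; ring
    rcases le_total q p' with hqp | hqp
    -- Disjoint intervals: truncated subtraction makes the overlap length zero.
    · rw [hz q hq hqp, tsub_eq_zero_of_le ((min_le_left q q').trans hqp)]
      simp
    · rw [← hW.integral_weighted_increment_of_left_eq k l hqp hq'
        (hc.mono (𝓕.mono h) le_rfl) hd hcb hdb]
      have hi (u v : ℝ≥0) := ((hW.memLp_increment k u v).bounded_mul hc' hcb).integrable_mul_conj
        ((hW.memLp_increment l p' q').bounded_mul hd' hdb)
      refine Eq.trans ?_ (zero_add _)
      rw [← hz p' h le_rfl, ← integral_add (hi _ _) (hi _ _)]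
      congr 1; ext ω; ring
  · rw [max_eq_left h]
    have hz (r : ℝ≥0) (hr : p' ≤ r) (hr' : r ≤ p) :
        ∫ ω, (c ω * (W k q ω - W k p ω)) * conj (d ω * (W l r ω - W l p' ω)) ∂P = 0 := by
      rw [← hW.integral_mul_increment k hq (X := fun ω ↦
        c ω * conj (d ω * (W l r ω - W l p' ω)))
        (hc.mul (hconj.comp (((hd.mono (𝓕.mono hr) le_rfl).mul
          (hW.measurable_increment l hr)).mono (𝓕.mono hr') le_rfl)))]
      congr 1; ext ω; ring
    rcases le_total q' p with hqp | hqp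
    · rw [hz q' hq' hqp, tsub_eq_zero_of_le ((min_le_right q q').trans hqp)]
      simp
    · rw [← hW.integral_weighted_increment_of_left_eq k l hq hqp
        hc (hd.mono (𝓕.mono h) le_rfl) hcb hdb]
      have hi (u v : ℝ≥0) := ((hW.memLp_increment k p q).bounded_mul hc' hcb).integrable_mul_conj
        ((hW.memLp_increment l u v).bounded_mul hd' hdb)
      refine Eq.trans ?_ (zero_add _)
      rw [← hz p h le_rfl, ← integral_add (hi _ _) (hi _ _)]
      congr 1; ext ω; simp only [map_mul, map_sub]; ring

end IsComplexWiener

/-! ### The Itô isometry, for simple processes and then for limits. -/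

instance isFiniteMeasure_timeMeasure (t : ℝ≥0) : IsFiniteMeasure (timeMeasure t) := by
  unfold timeMeasure
  infer_instance

/-- The end points are truncated by `min t`, exactly as in `SimpleProcess.integral`. -/
theorem timeMeasure_Ioc (t l r : ℝ≥0) :
    timeMeasure t (Set.Ioc l r) = ((min t r - min t l : ℝ≥0) : ℝ≥0∞) := by
  rw [timeMeasure, Measure.map_apply measurable_real_toNNReal measurableSet_Ioc,
    Measure.restrict_apply (measurable_real_toNNReal measurableSet_Ioc)]
  have h : Real.toNNReal ⁻¹' Set.Ioc l r ∩ Set.Icc (0 : ℝ) t =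
      Set.Ioc ((min t l : ℝ≥0) : ℝ) ((min t r : ℝ≥0) : ℝ) := by
    ext x
    constructor
    · rintro ⟨⟨h1, h2⟩, h3, h4⟩
      lift x to ℝ≥0 using h3
      rw [Real.toNNReal_coe] at h1 h2
      exact ⟨NNReal.coe_lt_coe.2 (min_lt_of_right_lt h1),
        NNReal.coe_le_coe.2 (le_min (NNReal.coe_le_coe.1 h4) h2)⟩
    · rintro ⟨h1, h2⟩
      have h3 : 0 ≤ x := (NNReal.coe_nonneg _).trans h1.le
      lift x to ℝ≥0 using h3
      rw [NNReal.coe_lt_coe] at h1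
      rw [NNReal.coe_le_coe, le_min_iff] at h2
      refine ⟨⟨?_, ?_⟩, NNReal.coe_nonneg _, NNReal.coe_le_coe.2 h2.1⟩
      · rw [Real.toNNReal_coe]
        exact (min_lt_iff.1 h1).resolve_left (not_lt.2 h2.1)
      · rw [Real.toNNReal_coe]
        exact h2.2
  rw [h, Real.volume_Ioc, ENNReal.ofReal, NNReal.sub_def]

namespace SimpleProcess

variable {Ω ι : Type*} [mΩ : MeasurableSpace Ω] {𝓕 : Filtration ℝ≥0 mΩ}
  {P : Measure Ω}

/-- The `i`-th summand of a simple process, as a function of time and sample point. -/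
noncomputable def term (φ : SimpleProcess 𝓕) (i : Fin φ.size) (p : ℝ≥0 × Ω) : ℂ :=
  (Set.Ioc (φ.left i) (φ.right i)).indicator (fun _ ↦ (1 : ℂ)) p.1 * φ.coef i p.2

theorem eval_eq_sum_term (φ : SimpleProcess 𝓕) (p : ℝ≥0 × Ω) :
    φ.eval p.1 p.2 = ∑ i, φ.term i p := by
  refine Finset.sum_congr rfl fun i _ ↦ ?_
  by_cases h : p.1 ∈ Set.Ioc (φ.left i) (φ.right i) <;> simp [term, h]

theorem measurable_coef' (φ : SimpleProcess 𝓕) (i : Fin φ.size) : Measurable (φ.coef i) :=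
  (φ.measurable_coef i).mono (𝓕.le _) le_rfl

theorem memLp_term [IsFiniteMeasure P] (φ : SimpleProcess 𝓕) (i : Fin φ.size) (t : ℝ≥0) :
    MemLp (φ.term i) 2 ((timeMeasure t).prod P) := by
  obtain ⟨C, hC⟩ := φ.bounded_coef i
  refine MemLp.of_bound (C := C) ?_ (ae_of_all _ fun p ↦ ?_)
  · exact (((measurable_const.indicator measurableSet_Ioc).comp measurable_fst).mul
      ((φ.measurable_coef' i).comp measurable_snd)).aestronglyMeasurable
  · have h0 : 0 ≤ C := (norm_nonneg _).trans (hC p.2)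
    by_cases h : p.1 ∈ Set.Ioc (φ.left i) (φ.right i) <;> simp [term, h, h0, hC p.2]

theorem memLp_eval [IsFiniteMeasure P] (φ : SimpleProcess 𝓕) (t : ℝ≥0) :
    MemLp (fun p : ℝ≥0 × Ω ↦ φ.eval p.1 p.2) 2 ((timeMeasure t).prod P) := by
  simp only [eval_eq_sum_term]
  exact memLp_finsetSum _ fun i _ ↦ φ.memLp_term i t

theorem integral_term_mul_conj [SFinite P] (φ ψ : SimpleProcess 𝓕) (i : Fin φ.size)
    (j : Fin ψ.size) (t : ℝ≥0) :
    ∫ p, φ.term i p * conj (ψ.term j p) ∂((timeMeasure t).prod P) =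
      (((min (min t (φ.right i)) (min t (ψ.right j)) -
        max (min t (φ.left i)) (min t (ψ.left j)) : ℝ≥0) : ℝ) : ℂ) *
        ∫ ω, φ.coef i ω * conj (ψ.coef j ω) ∂P := by
  have h : ∀ p : ℝ≥0 × Ω, φ.term i p * conj (ψ.term j p) =
      (Set.Ioc (max (φ.left i) (ψ.left j)) (min (φ.right i) (ψ.right j))).indicator
        (fun _ ↦ (1 : ℂ)) p.1 * (φ.coef i p.2 * conj (ψ.coef j p.2)) := by
    intro p
    rw [← Set.Ioc_inter_Ioc]
    by_cases h1 : p.1 ∈ Set.Ioc (φ.left i) (φ.right i) <;>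
      by_cases h2 : p.1 ∈ Set.Ioc (ψ.left j) (ψ.right j) <;>
        simp only [term, h1, h2, Set.indicator_of_mem, Set.indicator_of_notMem, Set.mem_inter_iff,
          not_false_eq_true, and_self, and_true, and_false, map_zero, one_mul,
          zero_mul, mul_zero]
  simp only [h]
  rw [integral_prod_mul (μ := timeMeasure t) (ν := P)
    ((Set.Ioc (max (φ.left i) (ψ.left j)) (min (φ.right i) (ψ.right j))).indicator
        (fun _ ↦ (1 : ℂ))) (fun ω ↦ φ.coef i ω * conj (ψ.coef j ω)),
    integral_indicator measurableSet_Ioc, setIntegral_const, Measure.real, timeMeasure_Ioc,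
    min_max_distrib_left,
    show min t (min (φ.right i) (ψ.right j)) = min (min t (φ.right i)) (min t (ψ.right j)) from
      inf_inf_distrib_left .., ENNReal.coe_toReal, Complex.real_smul, mul_one]

theorem integral_term_mul_conj_term [Fintype ι] {a : Matrix ι ι ℂ} {W : ι → ℝ≥0 → Ω → ℂ}
    (hW : IsComplexWiener 𝓕 P a W) (k l : ι) (φ ψ : SimpleProcess 𝓕) (i : Fin φ.size)
    (j : Fin ψ.size) (t : ℝ≥0) :
    ∫ ω, (φ.coef i ω * (W k (min t (φ.right i)) ω - W k (min t (φ.left i)) ω)) *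
      conj (ψ.coef j ω * (W l (min t (ψ.right j)) ω - W l (min t (ψ.left j)) ω)) ∂P =
      a k l * ∫ p, φ.term i p * conj (ψ.term j p) ∂((timeMeasure t).prod P) := by
  have := (hW.gaussian 0).isProbabilityMeasure
  rw [integral_term_mul_conj]
  -- An interval starting after `t` contributes zero on both sides. Otherwise truncation leaves the
  -- left end point unchanged, so the coefficient stays measurable with respect to its past.
  rcases le_total (φ.left i) t with h1 | h1
  · rcases le_total (ψ.left j) t with h2 | h2
    · rw [hW.integral_weighted_increment k l
        (min_le_min_left t (φ.left_le_right i)) (min_le_min_left t (ψ.left_le_right j))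
        (by rw [min_eq_right h1]; exact φ.measurable_coef i)
        (by rw [min_eq_right h2]; exact ψ.measurable_coef j)
        (φ.bounded_coef i) (ψ.bounded_coef j)]
      ring
    · rw [min_eq_left h2, min_eq_left (h2.trans (ψ.left_le_right j)),
        tsub_eq_zero_of_le ((min_le_right _ _).trans (le_max_right _ _))]
      simp
  · rw [min_eq_left h1, min_eq_left (h1.trans (φ.left_le_right i)),
      tsub_eq_zero_of_le ((min_le_left _ _).trans (le_max_left _ _))]
    simp

variable [Fintype ι] {a : Matrix ι ι ℂ} {W : ι → ℝ≥0 → Ω → ℂ}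

theorem memLp_integral (hW : IsComplexWiener 𝓕 P a W) (k : ι) (φ : SimpleProcess 𝓕) (t : ℝ≥0) :
    MemLp (φ.integral (W k) t) 2 P :=
  memLp_finsetSum _ fun i _ ↦
    (hW.memLp_increment k _ _).bounded_mul (φ.measurable_coef' i) (φ.bounded_coef i)

/-- The Itô isometry for simple processes. -/
theorem integral_integral_mul_conj (hW : IsComplexWiener 𝓕 P a W) (k l : ι)
    (φ ψ : SimpleProcess 𝓕) (t : ℝ≥0) :
    ∫ ω, φ.integral (W k) t ω * conj (ψ.integral (W l) t ω) ∂P =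
      a k l * ∫ p : ℝ≥0 × Ω, φ.eval p.1 p.2 * conj (ψ.eval p.1 p.2) ∂((timeMeasure t).prod P) := by
  have := (hW.gaussian 0).isProbabilityMeasure
  simp only [eval_eq_sum_term, integral, map_sum, Finset.sum_mul_sum]
  have hi := fun i j ↦ ((hW.memLp_increment k (min t (φ.left i)) (min t (φ.right i))).bounded_mul
    (φ.measurable_coef' i) (φ.bounded_coef i)).integrable_mul_conj
    ((hW.memLp_increment l (min t (ψ.left j)) (min t (ψ.right j))).bounded_mul
      (ψ.measurable_coef' j) (ψ.bounded_coef j))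
  have hi' := fun i j ↦ (φ.memLp_term (P := P) i t).integrable_mul_conj (ψ.memLp_term (P := P) j t)
  rw [integral_finsetSum _ fun i _ ↦ integrable_finsetSum _ fun j _ ↦ hi i j,
    integral_finsetSum _ fun i _ ↦ integrable_finsetSum _ fun j _ ↦ hi' i j, Finset.mul_sum]
  refine Finset.sum_congr rfl fun i _ ↦ ?_
  rw [integral_finsetSum _ fun j _ ↦ hi i j, integral_finsetSum _ fun j _ ↦ hi' i j,
    Finset.mul_sum]
  exact Finset.sum_congr rfl fun j _ ↦ integral_term_mul_conj_term hW k l φ ψ i j t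

end SimpleProcess

/-- Joint continuity of the $L^2$ inner product, applied both on `Ω` and on time × `Ω`. -/
theorem tendsto_integral_mul_conj {α : Type*} {m : MeasurableSpace α} {μ : Measure α}
    {f g : ℕ → α → ℂ} {f' g' : α → ℂ} (hf : ∀ n, MemLp (f n) 2 μ) (hg : ∀ n, MemLp (g n) 2 μ)
    (hf' : MemLp f' 2 μ) (hg' : MemLp g' 2 μ)
    (hft : Tendsto (fun n ↦ eLpNorm (fun x ↦ f n x - f' x) 2 μ) atTop (𝓝 0))
    (hgt : Tendsto (fun n ↦ eLpNorm (fun x ↦ g n x - g' x) 2 μ) atTop (𝓝 0)) :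
    Tendsto (fun n ↦ ∫ x, f n x * conj (g n x) ∂μ) atTop (𝓝 (∫ x, f' x * conj (g' x) ∂μ)) := by
  have h (u v : α → ℂ) (hu : MemLp u 2 μ) (hv : MemLp v 2 μ) :
      ∫ x, u x * conj (v x) ∂μ = inner ℂ (hv.toLp v) (hu.toLp u) := by
    rw [L2.inner_def]
    refine integral_congr_ae ?_
    filter_upwards [hu.coeFn_toLp, hv.coeFn_toLp] with x h1 h2
    rw [h1, h2, RCLike.inner_apply]
  rw [h _ _ hf' hg']
  simp only [fun n ↦ h _ _ (hf n) (hg n)]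
  exact Tendsto.inner ((Lp.tendsto_Lp_iff_tendsto_eLpNorm'' g hg g' hg').2 hgt)
    ((Lp.tendsto_Lp_iff_tendsto_eLpNorm'' f hf f' hf').2 hft)

/-- The Itô isometry, for two components of a complex Wiener process. -/
theorem IsItoIntegral.integral_mul_conj {Ω ι : Type*} [mΩ : MeasurableSpace Ω] [Fintype ι]
    {𝓕 : Filtration ℝ≥0 mΩ} {P : Measure Ω} {a : Matrix ι ι ℂ} {W : ι → ℝ≥0 → Ω → ℂ}
    (hW : IsComplexWiener 𝓕 P a W) {k l : ι} {f g : ℝ≥0 → Ω → ℂ} {t : ℝ≥0} {X Y : Ω → ℂ}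
    (hf : MemLp (fun p : ℝ≥0 × Ω ↦ f p.1 p.2) 2 ((timeMeasure t).prod P))
    (hg : MemLp (fun p : ℝ≥0 × Ω ↦ g p.1 p.2) 2 ((timeMeasure t).prod P))
    (hX : IsItoIntegral 𝓕 P (W k) f t X) (hY : IsItoIntegral 𝓕 P (W l) g t Y) :
    ∫ ω, X ω * conj (Y ω) ∂P =
      a k l * ∫ p : ℝ≥0 × Ω, f p.1 p.2 * conj (g p.1 p.2) ∂((timeMeasure t).prod P) := by
  have := (hW.gaussian 0).isProbabilityMeasure
  obtain ⟨hX2, φ, hφ, hφX⟩ := hX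
  obtain ⟨hY2, ψ, hψ, hψY⟩ := hY
  have h1 := tendsto_integral_mul_conj (fun n ↦ (φ n).memLp_integral hW k t)
    (fun n ↦ (ψ n).memLp_integral hW l t) hX2 hY2 hφX hψY
  have h2 := tendsto_integral_mul_conj (fun n ↦ (φ n).memLp_eval t)
    (fun n ↦ (ψ n).memLp_eval t) hf hg hφ hψ
  simp only [SimpleProcess.integral_integral_mul_conj hW] at h1
  exact tendsto_nhds_unique h1 (h2.const_mul (a k l))

/-! ### Expectations and second moments of random matrices. -/

section MatrixExpectation

variable {Ω n : Type*} [MeasurableSpace Ω] {P : Measure Ω}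

theorem matrixExpectation_congr {X Y : Ω → Matrix n n ℂ} (h : X =ᵐ[P] Y) :
    matrixExpectation P X = matrixExpectation P Y := by
  ext i j
  exact integral_congr_ae (h.mono fun ω hω ↦ congrFun (congrFun hω i) j)

theorem matrixExpectation_const [IsProbabilityMeasure P] (A : Matrix n n ℂ) :
    matrixExpectation P (fun _ ↦ A) = A := by
  ext i j
  simp [matrixExpectation]

variable [Fintype n]

theorem trace_matrixExpectation {X : Ω → Matrix n n ℂ}
    (hX : ∀ i j, Integrable (fun ω ↦ X ω i j) P) :
    (matrixExpectation P X).trace = ∫ ω, (X ω).trace ∂P := by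
  simp only [Matrix.trace, Matrix.diag]
  rw [integral_finsetSum _ fun i _ ↦ hX i i]
  rfl

theorem integrable_matrix_mul_const {X : Ω → Matrix n n ℂ} (A : Matrix n n ℂ)
    (hX : ∀ i j, Integrable (fun ω ↦ X ω i j) P) (i j : n) :
    Integrable (fun ω ↦ (X ω * A) i j) P := by
  simp only [Matrix.mul_apply]
  exact integrable_finsetSum _ fun r _ ↦ (hX i r).mul_const _

theorem matrixExpectation_mul_const {X : Ω → Matrix n n ℂ} (A : Matrix n n ℂ)
    (hX : ∀ i j, Integrable (fun ω ↦ X ω i j) P) :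
    matrixExpectation P (fun ω ↦ X ω * A) = matrixExpectation P X * A := by
  ext i j
  simp only [matrixExpectation, Matrix.of_apply, Matrix.mul_apply]
  rw [integral_finsetSum _ fun r _ ↦ (hX i r).mul_const _]
  exact Finset.sum_congr rfl fun r _ ↦ integral_mul_const _ _

theorem integrable_conjTranspose_mul {X Y : Ω → Matrix n n ℂ}
    (hX : ∀ i j, MemLp (fun ω ↦ X ω i j) 2 P) (hY : ∀ i j, MemLp (fun ω ↦ Y ω i j) 2 P)
    (i j : n) : Integrable (fun ω ↦ ((X ω).conjTranspose * Y ω) i j) P := by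
  simp only [Matrix.mul_apply, Matrix.conjTranspose_apply]
  refine integrable_finsetSum _ fun r _ ↦ ?_
  simpa only [mul_comm, starRingEnd_apply] using (hY r j).integrable_mul_conj (hX r i)

theorem integral_conjTranspose_mul_apply {X Y : Ω → Matrix n n ℂ}
    (hX : ∀ i j, MemLp (fun ω ↦ X ω i j) 2 P) (hY : ∀ i j, MemLp (fun ω ↦ Y ω i j) 2 P)
    (i j : n) : ∫ ω, ((X ω).conjTranspose * Y ω) i j ∂P =
      ∑ r, ∫ ω, Y ω r j * conj (X ω r i) ∂P := by
  simp only [Matrix.mul_apply, Matrix.conjTranspose_apply]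
  rw [← integral_finsetSum _ fun r _ ↦ (hY r j).integrable_mul_conj (hX r i)]
  simp only [mul_comm, starRingEnd_apply]

/-- Cyclicity of the trace: all initial states are tested against the single matrix
$\mathbb{E}[U^\dagger U]$. -/
theorem trace_rhoQM {U : ℝ≥0 → Ω → Matrix n n ℂ} {t : ℝ≥0}
    (hU : ∀ i j, MemLp (fun ω ↦ U t ω i j) 2 P) (ρ : Matrix n n ℂ) :
    (rhoQM P U ρ t).trace =
      (matrixExpectation P (fun ω ↦ (U t ω).conjTranspose * U t ω) * ρ).trace := by
  have hM := integrable_conjTranspose_mul hU hU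
  rw [← matrixExpectation_mul_const _ hM,
    trace_matrixExpectation (integrable_matrix_mul_const ρ hM), rhoQM, trace_matrixExpectation]
  · congr 1; ext ω
    rw [Matrix.trace_mul_comm, ← mul_assoc]
  · intro i j
    simp only [Matrix.mul_apply, Matrix.conjTranspose_apply, Finset.sum_mul]
    refine integrable_finsetSum _ fun r _ ↦ integrable_finsetSum _ fun s _ ↦ ?_
    refine (((hU i s).integrable_mul_conj (hU j r)).mul_const (ρ s r)).congr
      (ae_of_all _ fun ω ↦ ?_)
    simp only [starRingEnd_apply]
    ring

/-- The second moment of a random matrix is that of its mean plus that of its fluctuation. -/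
theorem matrixExpectation_conjTranspose_mul_self [IsProbabilityMeasure P]
    {X Z : Ω → Matrix n n ℂ} (hZ : ∀ i j, MemLp (fun ω ↦ Z ω i j) 2 P)
    (h : ∀ᵐ ω ∂P, X ω = matrixExpectation P X + Z ω) :
    matrixExpectation P (fun ω ↦ (X ω).conjTranspose * X ω) =
      (matrixExpectation P X).conjTranspose * matrixExpectation P X +
        matrixExpectation P (fun ω ↦ (Z ω).conjTranspose * Z ω) := by
  have hE := matrixExpectation_congr h
  set A := matrixExpectation P X
  have hZ1 := fun i j ↦ (hZ i j).integrable one_le_two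
  -- Taking expectations in `h` already forces `Z` to be centred; the zero mean of Itô integrals is
  -- not needed separately.
  have hmean : ∀ i j, ∫ ω, Z ω i j ∂P = 0 := by
    intro i j
    have h1 : A i j = ∫ ω, (A i j + Z ω i j) ∂P := congrFun (congrFun hE i) j
    rw [integral_add (integrable_const _) (hZ1 i j)] at h1
    simpa using h1
  have hc : ∀ i j, MemLp (fun _ : Ω ↦ A i j) 2 P := fun i j ↦ memLp_const _
  rw [matrixExpectation_congr (Y := fun ω ↦ (A + Z ω).conjTranspose * (A + Z ω))
    (h.mono fun ω hω ↦ by simp only [← hω])]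
  ext i j
  have hAZ : ∫ ω, (A.conjTranspose * Z ω) i j ∂P = 0 := by
    rw [integral_conjTranspose_mul_apply hc hZ]
    exact Finset.sum_eq_zero fun r _ ↦ by rw [integral_mul_const, hmean, zero_mul]
  have hZA : ∫ ω, ((Z ω).conjTranspose * A) i j ∂P = 0 := by
    rw [integral_conjTranspose_mul_apply hZ hc]
    exact Finset.sum_eq_zero fun r _ ↦ by
      rw [integral_const_mul, integral_conj, hmean, map_zero, mul_zero]
  have i1 := integrable_conjTranspose_mul hZ hZ i j
  have i2 := integrable_conjTranspose_mul hc hZ i j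
  have i3 := integrable_conjTranspose_mul hZ hc i j
  simp only [matrixExpectation, Matrix.of_apply, Matrix.add_apply, Matrix.conjTranspose_add,
    add_mul, mul_add]
  have i4 : Integrable (fun ω ↦ (A.conjTranspose * A) i j + ((Z ω).conjTranspose * A) i j) P :=
    (integrable_const _).add i3
  have i5 : Integrable (fun ω ↦ (A.conjTranspose * Z ω) i j +
    ((Z ω).conjTranspose * Z ω) i j) P := i2.add i1
  rw [integral_add i4 i5, integral_add (integrable_const _) i3,
    integral_add i2 i1, hAZ, hZA]
  simp

end MatrixExpectation

/-! ### The operator-valued isometry and the second moment of the evolution. -/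

section Noise

variable {Ω ι n : Type*} [mΩ : MeasurableSpace Ω] [Fintype ι] [Fintype n] {P : Measure Ω}
  {𝓕 : Filtration ℝ≥0 mΩ} {a : Matrix ι ι ℂ} {W : ι → ℝ≥0 → Ω → ℂ}
  {v : ι → ℝ≥0 → Ω → Matrix n n ℂ}

/-- Fubini: expectation and time integral merge into one integral over the product, the form in
which the scalar isometry delivers covariances. -/
theorem matrixExpectation_noiseOperator_apply [SFinite P] (hv : ∀ k, IsItoIntegrand 𝓕 P (v k))
    (t : ℝ≥0) (i j : n) :
    matrixExpectation P (noiseOperator a v t) i j =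
      ∑ k, ∑ l, a k l * ∑ r, ∫ p : ℝ≥0 × Ω, v k p.1 p.2 r j * conj (v l p.1 p.2 r i)
        ∂((timeMeasure t).prod P) := by
  have h2 := fun k i j ↦ (hv k).square_integrable i j t
  have hint := fun k l ↦ integrable_conjTranspose_mul (X := fun p : ℝ≥0 × Ω ↦ v l p.1 p.2)
    (Y := fun p : ℝ≥0 × Ω ↦ v k p.1 p.2) (h2 l) (h2 k) i j
  simp only [matrixExpectation, noiseOperator, matrixTimeIntegral, Matrix.of_apply,
    Matrix.sum_apply, Matrix.smul_apply, smul_eq_mul]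
  have hint' := fun k l ↦ (hint k l).integral_prod_right.const_mul (a k l)
  rw [integral_finsetSum _ fun k _ ↦ integrable_finsetSum _ fun l _ ↦ hint' k l]
  refine Finset.sum_congr rfl fun k _ ↦ ?_
  rw [integral_finsetSum _ fun l _ ↦ hint' k l]
  refine Finset.sum_congr rfl fun l _ ↦ ?_
  rw [integral_const_mul, ← integral_prod_symm _ (hint k l),
    integral_conjTranspose_mul_apply (X := fun p : ℝ≥0 × Ω ↦ v l p.1 p.2)
      (Y := fun p : ℝ≥0 × Ω ↦ v k p.1 p.2) (h2 l) (h2 k)]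

/-- The operator-valued Itô isometry. -/
theorem matrixExpectation_conjTranspose_mul_self_itoIntegral (hW : IsComplexWiener 𝓕 P a W)
    (hv : ∀ k, IsItoIntegrand 𝓕 P (v k)) {t : ℝ≥0} {J : ι → Ω → Matrix n n ℂ}
    (hJ : ∀ k, IsMatrixItoIntegral 𝓕 P (W k) (v k) t (J k)) :
    matrixExpectation P (fun ω ↦ (∑ k, J k ω).conjTranspose * ∑ k, J k ω) =
      matrixExpectation P (noiseOperator a v t) := by
  have := (hW.gaussian 0).isProbabilityMeasure
  have hZ : ∀ i j, MemLp (fun ω ↦ (∑ k, J k ω) i j) 2 P := fun i j ↦ by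
    simp only [Matrix.sum_apply]
    exact memLp_finsetSum _ fun k _ ↦ (hJ k i j).1
  ext i j
  rw [matrixExpectation_noiseOperator_apply hv, matrixExpectation, Matrix.of_apply,
    integral_conjTranspose_mul_apply hZ hZ]
  simp only [Finset.mul_sum]
  rw [Finset.sum_congr rfl fun k _ ↦ Finset.sum_comm, Finset.sum_comm]
  refine Finset.sum_congr rfl fun r _ ↦ ?_
  simp only [Matrix.sum_apply, map_sum, Finset.sum_mul_sum]
  have hi := fun k l ↦ (hJ k r j).1.integrable_mul_conj (hJ l r i).1
  rw [integral_finsetSum _ fun k _ ↦ integrable_finsetSum _ fun l _ ↦ hi k l]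
  refine Finset.sum_congr rfl fun k _ ↦ ?_
  rw [integral_finsetSum _ fun l _ ↦ hi k l]
  exact Finset.sum_congr rfl fun l _ ↦ IsItoIntegral.integral_mul_conj hW
    ((hv k).square_integrable r j t) ((hv l).square_integrable r i t) (hJ k r j) (hJ l r i)

theorem IsStochasticEvolution.memLp_and_second_moment [DecidableEq n]
    (hW : IsComplexWiener 𝓕 P a W) (hv : ∀ k, IsItoIntegrand 𝓕 P (v k))
    {U : ℝ≥0 → Ω → Matrix n n ℂ} (hU : IsStochasticEvolution 𝓕 P W v U) (t : ℝ≥0) :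
    (∀ i j, MemLp (fun ω ↦ U t ω i j) 2 P) ∧
    matrixExpectation P (fun ω ↦ (U t ω).conjTranspose * U t ω) =
      (matrixExpectation P (U t)).conjTranspose * matrixExpectation P (U t) +
        matrixExpectation P (noiseOperator a v t) := by
  have := (hW.gaussian 0).isProbabilityMeasure
  obtain ⟨J, hJ, h⟩ := hU.decomposition t
  have hZ : ∀ i j, MemLp (fun ω ↦ (∑ k, J k ω) i j) 2 P := fun i j ↦ by
    simp only [Matrix.sum_apply]
    exact memLp_finsetSum _ fun k _ ↦ (hJ k i j).1
  refine ⟨fun i j ↦ ?_, ?_⟩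
  -- Square integrability of `U t` is derived: almost surely it is a constant matrix plus Itô
  -- integrals in $L^2$, whatever value the Bochner integral assigns to that constant.
  · refine ((memLp_const (matrixExpectation P (U t) i j)).add (hZ i j)).ae_eq ?_
    filter_upwards [h] with ω hω
    conv_rhs => rw [hω]
    rfl
  · rw [matrixExpectation_conjTranspose_mul_self hZ h,
      matrixExpectation_conjTranspose_mul_self_itoIntegral hW hv hJ]

theorem trace_rhoQM_zero [IsProbabilityMeasure P] {U : ℝ≥0 → Ω → Matrix n n ℂ} [DecidableEq n]
    (hU : ∀ᵐ ω ∂P, U 0 ω = 1) {ρ : Matrix n n ℂ} (hρ : IsDensityMatrix ρ) :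
    (rhoQM P U ρ 0).trace = 1 := by
  rw [rhoQM, matrixExpectation_congr (Y := fun _ ↦ ρ), matrixExpectation_const, hρ.2]
  filter_upwards [hU] with ω hω
  simp [hω]

end Noise

theorem proposition1 {Ω ι : Type*} [mΩ : MeasurableSpace Ω] [Fintype ι] {N : ℕ}
    (P : Measure Ω) [IsProbabilityMeasure P] (𝓕 : Filtration ℝ≥0 mΩ)
    (a : Matrix ι ι ℂ) (W : ι → ℝ≥0 → Ω → ℂ) (hW : IsComplexWiener 𝓕 P a W)
    (v : ι → ℝ≥0 → Ω → Matrix (Fin N) (Fin N) ℂ) (hv : ∀ k, IsItoIntegrand 𝓕 P (v k))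
    (U : ℝ≥0 → Ω → Matrix (Fin N) (Fin N) ℂ) (hU : IsStochasticEvolution 𝓕 P W v U)
    (t : ℝ≥0)
    (htrace : ∀ ρ₀ : Matrix (Fin N) (Fin N) ℂ, IsDensityMatrix ρ₀ →
      (rhoQM P U ρ₀ t).trace = (rhoQM P U ρ₀ 0).trace) :
    (1 - matrixExpectation P (noiseOperator a v t)).PosSemidef ∧
    ∃ H : Matrix (Fin N) (Fin N) ℂ, H.IsHermitian ∧
      matrixExpectation P (U t) =
        NormedSpace.exp ((-(Complex.I * ((t : ℝ) : ℂ))) • H) *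
          CFC.sqrt (1 - matrixExpectation P (noiseOperator a v t)) ∧
      ((∀ k s ω ω', v k s ω = v k s ω') → ∀ ω,
        (1 - noiseOperator a v t ω).PosSemidef ∧
        matrixExpectation P (U t) =
          NormedSpace.exp ((-(Complex.I * ((t : ℝ) : ℂ))) • H) *
            CFC.sqrt (1 - noiseOperator a v t ω)) := by
  obtain ⟨hU2, hmoment⟩ := hU.memLp_and_second_moment hW hv t
  have hone : matrixExpectation P (fun ω ↦ (U t ω).conjTranspose * U t ω) = 1 :=
    Matrix.eq_one_of_forall_isDensityMatrix _ fun ρ hρ ↦ by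
      rw [← trace_rhoQM hU2, htrace ρ hρ, trace_rhoQM_zero hU.start_one hρ]
  set A := matrixExpectation P (U t) with hA
  have hS : 1 - matrixExpectation P (noiseOperator a v t) = A.conjTranspose * A :=
    sub_eq_of_eq_add (hone.symm.trans hmoment)
  have hpos := Matrix.posSemidef_conjTranspose_mul_self A
  -- Nonrandom coefficients make the noise operator constant in `ω`, hence equal to its mean; the
  -- same `H` then serves both formulas.
  have hdet : (∀ k s ω ω', v k s ω = v k s ω') → ∀ ω,
      noiseOperator a v t ω = matrixExpectation P (noiseOperator a v t) := by
    intro h ω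
    have h1 : noiseOperator a v t = fun _ ↦ noiseOperator a v t ω := by
      ext1 ω'
      simp only [noiseOperator, h _ _ ω' ω]
    conv_rhs => rw [h1, matrixExpectation_const]
  obtain ⟨H, hH, hexp⟩ : ∃ H : Matrix (Fin N) (Fin N) ℂ, H.IsHermitian ∧
      A = NormedSpace.exp ((-(Complex.I * ((t : ℝ) : ℂ))) • H) *
        CFC.sqrt (A.conjTranspose * A) := by
    -- At time zero the rescaling by $1/t$ is unavailable, but there `A = 1` and `H = 0` works.
    rcases eq_or_ne t 0 with rfl | ht
    · have hA1 : A = 1 := by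
        rw [hA, matrixExpectation_congr (Y := fun _ ↦ 1) hU.start_one, matrixExpectation_const]
      refine ⟨0, Matrix.isHermitian_zero, ?_⟩
      rw [hA1]
      simp [CFC.sqrt_one]
    · exact A.exists_exp_mul_sqrt (Complex.conj_ofReal _) (by simpa using ht)
  refine ⟨hS ▸ hpos, H, hH, ?_, fun h ω ↦ ?_⟩
  · rw [hS]
    exact hexp
  · rw [hdet h ω, hS]
    exact ⟨hpos, hexp⟩
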